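/- **Language.** Let $\mathsf{Prop}$ and $\mathsf{Nom}$ be sets of propositional variables and nominals. Formulas of the expanded modal language are built from $p\in\mathsf{Prop}$, $\mathbf i\in\mathsf{Nom}$, $\top,\bot$ by $\neg,\land,\lor,\to,\Box,\Diamond,\blacklozenge,\blacksquare$ (all taken as primitive). A formula is *basic* if it contains no nominal and no $\blacklozenge,\blacksquare$; it is *pure* if it contains no propositional variable. An *inequality* is an expression $\varphi\le\psi$; a *system* $(S,\mathsf{Ineq})$ consists of a finite set $S$ of inequalities and an inequality $\mathsf{Ineq}$. **Frames.** For a partial order $(W,\sqsubseteq)$ let $\mathsf{cl}(X)=\{x:\exists y\sqsubseteq x,\ y\in X\}$ and $\mathsf{int}(X)=\{x:\forall y\sqsubseteq x,\ y\in X\}$; $X$ is *regular open* if $\mathsf{int}(\mathsf{cl}(X))=X$, and $\mathsf{ro}(X)$ is the least regular open set containing $X$. A *possibility frame* is $(W,\sqsubseteq,R,\mathsf P)$ with $W\ne\emptyset$, $R\subseteq W^2$, and $\mathsf P$ a Boolean subalgebra of the regular open sets closed under $X\mapsto\{w: R[w]\subseteq X\}$; it is *full* if $\mathsf P$ is the set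 of all regular open sets. Given $V:\mathsf{Prop}\to\mathsf P$ and an interpretation of each nominal $\mathbf i$ by a set $V(\mathbf i)=\mathsf{ro}(\{w_{\mathbf i}\})$, satisfaction is: $w\vDash p$ (resp. $\mathbf i$) iff $w\in V(p)$ (resp. $V(\mathbf i)$); $\top$ always, $\bot$ never, $\land$ pointwise; $w\vDash\neg\varphi$ iff $\forall v\sqsubseteq w$, $v\nvDash\varphi$; $w\vDash\varphi\lor\psi$ iff $\forall v\sqsubseteq w\,\exists u\sqsubseteq v$ ($u\vDash\varphi$ or $u\vDash\psi$); $w\vDash\varphi\to\psi$ iff $\forall v\sqsubseteq w$ ($v\vDash\varphi\Rightarrow v\vDash\psi$); $w\vDash\Box\varphi$ iff $\forall v(Rwv\Rightarrow v\vDash\varphi)$; $w\vDash\Diamond\varphi$ iff $\forall v\sqsubseteq w\,\exists u(Rvu\ \&\ \exists t\sqsubseteq u,\ t\vDash\varphi)$; $w\vDash\blacklozenge\varphi$ iff $\forall v\sqsubseteq w\,\exists u\sqsubseteq v\,\exists t\sqsupseteq u\,\exists s(Rst\ \&\ s\vDash\varphi)$; $w\vDash\blacksquare\varphi$ iff $\forall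 v\sqsubseteq w\,\forall u\sqsupseteq v\,\forall t(Rtu\Rightarrow\exists s\sqsubseteq t,\ s\vDash\varphi)$. (On a full frame $\blacklozenge$ and $\blacksquare$ are thus the left adjoint of $\Box$ and the right adjoint of $\Diamond$ on regular open sets.) $\mathbb F\vDash\varphi\le\psi$ means that for every such $V$ and every $w\in W$, $w\vDash\varphi$ implies $w\vDash\psi$. **Translation.** $ST_x$ maps formulas to first-order formulas over $\sqsubseteq$, $R$, unary predicates $P_p$ ($p\in\mathsf{Prop}$) and individual symbols $i$ ($\mathbf i\in\mathsf{Nom}$): $ST_x(p)=P_px$, $ST_x(\mathbf i)=(\forall y\sqsubseteq x)(\exists z\sqsubseteq y)(\exists z'\sqsupseteq z)(i=z')$, and the other clauses are the satisfaction clauses above written as first-order formulas. For a list of pure systems $(S_1,\mathsf{Ineq}_1),\dots,(S_n,\mathsf{Ineq}_n)$ with $\mathsf{Ineq}_k=(\varphi_k\le\psi_k)$ the first-order output is the sentence over $\sqsubseteq,R$ $$\bigwedge_{k}\forall\vec{j_k}\Big(\bigwedge_{(\xi\le\chi)\in S_k}\forall x(ST_x(\xi)\to ST_x(\chi))\to\forall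 x(ST_x(\varphi_k)\to ST_x(\psi_k))\Big),$$ where $\vec{j_k}$ are the individual symbols occurring in the $k$-th conjunct. **Signs.** Label the root of the tree of $\varphi$ by $+$ or $-$ and pass signs to children unchanged, except that $\neg$ and the first argument of $\to$ reverse them. $\varphi$ is positive (negative) in $p$ if all occurrences of $p$ in $+\varphi$ are signed $+$ (resp. $-$). SLR nodes are $+\land,+\Diamond,+\neg,-\lor,-\Box,-\neg,-\to$. $\varphi(!x)$ denotes a formula with exactly one occurrence of a placeholder $x$. **The algorithm.** A run of ALBA on an inequality $\varphi\le\psi$ of basic formulas: *Stage 1.* Starting from $\{\varphi\le\psi\}$, finitely many times replace an inequality in the set by the result of a rule: (a) distribution, in the trees $+\text{lhs}$ and $-\text{rhs}$, at any node: distribute $+\Diamond$, $+\land$, $-\neg$, $-\to$ (in its first argument) over a child $+\lor$, and $-\Box$, $-\lor$, $+\neg$, $-\to$ (in its second argument) over a child $-\land$ (where $\neg$ and the first argument of $\to$ exchange $\lor$ and $\land$); (b) if $\alpha$ is negative and $\beta$ positive in $p$: $\alpha(p)\le\beta(p)\rightsquigarrow\alpha(\bot)\le\beta(\bot)$ and $\beta(p)\le\alpha(p)\rightsquigarrow\beta(\top)\le\alpha(\top)$;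 (c) splitting: $\alpha\le\beta\land\gamma\rightsquigarrow\alpha\le\beta,\ \alpha\le\gamma$ and $\alpha\lor\beta\le\gamma\rightsquigarrow\alpha\le\gamma,\ \beta\le\gamma$. *Stage 2.* Each resulting inequality $e$ gives the initial system $(\emptyset,e)$, which is rewritten finitely many times by: (a) approximation: if the branch of $x$ in $+\varphi'(!x)$ consists, apart from $x$, of SLR nodes, $\gamma$ is basic and $\mathbf i$ does not occur in the system, then $(S,\varphi'(\gamma)\le\psi')\rightsquigarrow(S\cup\{\mathbf i\le\gamma\},\varphi'(\mathbf i)\le\psi')$ if $x$ is signed $+$, and $\rightsquigarrow(S\cup\{\gamma\le\neg\mathbf i\},\varphi'(\neg\mathbf i)\le\psi')$ if $x$ is signed $-$; likewise $(S,\varphi'\le\psi'(\gamma))\rightsquigarrow(S\cup\{\mathbf i\le\gamma\},\varphi'\le\psi'(\mathbf i))$, resp. $(S\cup\{\gamma\le\neg\mathbf i\},\varphi'\le\psi'(\neg\mathbf i))$, with the signs taken in $-\psi'(!x)$; (b) residuation, replacing an inequality in $S$: $\Diamond\gamma\le\delta\rightsquigarrow\gamma\le\blacksquare\delta$; $\neg\gamma\le\delta\rightsquigarrow\neg\delta\le\gamma$;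 $\gamma\le\Box\delta\rightsquigarrow\blacklozenge\gamma\le\delta$; $\gamma\le\neg\delta\rightsquigarrow\delta\le\neg\gamma$; $\gamma\land\delta\le\beta\rightsquigarrow\gamma\le\delta\to\beta$ or $\delta\le\gamma\to\beta$; $\gamma\le\delta\lor\beta\rightsquigarrow\gamma\land\neg\delta\le\beta$ or $\gamma\land\neg\beta\le\delta$; $\gamma\le\delta\to\beta\rightsquigarrow\gamma\land\delta\le\beta$ or $\delta\le\gamma\to\beta$; (c) the splitting rules, applied to an inequality in $S$; (d) Ackermann rules, for $p$ not occurring in any $\alpha_i$ or in $\mathsf{Ineq}$: $(\{\alpha_i\le p\}_{i\le n}\cup\{\beta_j(p)\le\gamma_j(p)\}_{j\le m},\mathsf{Ineq})\rightsquigarrow(\{\beta_j(\bigvee_i\alpha_i)\le\gamma_j(\bigvee_i\alpha_i)\}_{j\le m},\mathsf{Ineq})$ if all $\beta_j$ are positive and all $\gamma_j$ negative in $p$; and $(\{p\le\alpha_i\}_{i\le n}\cup\{\beta_j(p)\le\gamma_j(p)\}_{j\le m},\mathsf{Ineq})\rightsquigarrow(\{\beta_j(\bigwedge_i\alpha_i)\le\gamma_j(\bigwedge_i\alpha_i)\}_{j\le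 m},\mathsf{Ineq})$ if all $\beta_j$ are negative and all $\gamma_j$ positive in $p$ (here $n,m\ge 0$, $\bigvee\emptyset=\bot$, $\bigwedge\emptyset=\top$). *Stage 3.* The run *succeeds* if every system has been rewritten to a pure one; it then outputs the first-order output $\mathsf{FO}(\varphi\le\psi)$ of these pure systems. Runs need not be exhaustive in Stage 1 nor use only maximal SLR branches in Stage 2(a); runs that do are included. **Theorem (Soundness).** Let $\varphi,\psi$ be basic formulas. If some run of ALBA succeeds on $\varphi\le\psi$ and outputs $\mathsf{FO}(\varphi\le\psi)$, then for every full possibility frame $\mathbb F$, $$\mathbb F\vDash\varphi\le\psi\quad\text{iff}\quad\mathbb F\vDash\mathsf{FO}(\varphi\le\psi).$$ -/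

import Mathlib

namespace PossALBA

open FirstOrder FirstOrder.Language

universe u v w

/-! ## The expanded modal language -/

/-- Formulas of the expanded modal language over propositional variables `P` and nominals `N`.
The abbreviations `⊤, ⊥, ∨, →, ◇, ■` are taken as primitive symbols; `bdia` is the black diamond
and `bbox` the black box. -/
inductive MForm (P : Type u) (N : Type v) : Type (max u v)
  | prop (p : P) : MForm P N
  | nom (i : N) : MForm P N
  | top : MForm P N
  | bot : MForm P N
  | neg (a : MForm P N) : MForm P N
  | and (a b : MForm P N) : MForm P N
  | or (a b : MForm P N) : MForm P N
  | imp (a b : MForm P N) : MForm P N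
  | box (a : MForm P N) : MForm P N
  | dia (a : MForm P N) : MForm P N
  | bdia (a : MForm P N) : MForm P N
  | bbox (a : MForm P N) : MForm P N
  deriving DecidableEq

/-- An inequality `lhs ≤ rhs`. -/
@[ext]
structure Ineq (P : Type u) (N : Type v) : Type (max u v) where
  lhs : MForm P N
  rhs : MForm P N
  deriving DecidableEq

/-- A system `(S, Ineq)`, that is, the quasi-inequality `& S ⇒ Ineq`. -/
@[ext]
structure System (P : Type u) (N : Type v) : Type (max u v) where
  prem : Finset (Ineq P N)
  concl : Ineq P N

/-- The two signs of a signed generation tree. -/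
inductive Sign : Type
  | pos : Sign
  | neg : Sign

/-- The opposite sign. -/
def Sign.flip : Sign → Sign
  | .pos => .neg
  | .neg => .pos

namespace MForm

variable {P : Type u} {N : Type v}

/-- The formula belongs to the basic modal language: no nominals and no black connectives. -/
def IsBasic : MForm P N → Prop
  | prop _ => True
  | nom _ => False
  | top => True
  | bot => True
  | neg a => a.IsBasic
  | and a b => a.IsBasic ∧ b.IsBasic
  | or a b => a.IsBasic ∧ b.IsBasic
  | imp a b => a.IsBasic ∧ b.IsBasic
  | box a => a.IsBasic
  | dia a => a.IsBasic
  | bdia _ => False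
  | bbox _ => False

/-- The propositional variable `p` occurs in the formula. -/
def Occ (p : P) : MForm P N → Prop
  | prop q => q = p
  | nom _ => False
  | top => False
  | bot => False
  | neg a => a.Occ p
  | and a b => a.Occ p ∨ b.Occ p
  | or a b => a.Occ p ∨ b.Occ p
  | imp a b => a.Occ p ∨ b.Occ p
  | box a => a.Occ p
  | dia a => a.Occ p
  | bdia a => a.Occ p
  | bbox a => a.Occ p

/-- The nominal `i` occurs in the formula. -/
def NomOcc (i : N) : MForm P N → Prop
  | prop _ => False
  | nom j => j = i
  | top => False
  | bot => False
  | neg a => a.NomOcc i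
  | and a b => a.NomOcc i ∨ b.NomOcc i
  | or a b => a.NomOcc i ∨ b.NomOcc i
  | imp a b => a.NomOcc i ∨ b.NomOcc i
  | box a => a.NomOcc i
  | dia a => a.NomOcc i
  | bdia a => a.NomOcc i
  | bbox a => a.NomOcc i

/-- `SignedOcc s p r φ`: when the root of the generation tree of `φ` is given the sign `r`,
some leaf `p` receives the sign `s`. -/
def SignedOcc (s : Sign) (p : P) : Sign → MForm P N → Prop
  | r, prop q => q = p ∧ r = s
  | _, nom _ => False
  | _, top => False
  | _, bot => False
  | r, neg a => SignedOcc s p r.flip a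
  | r, and a b => SignedOcc s p r a ∨ SignedOcc s p r b
  | r, or a b => SignedOcc s p r a ∨ SignedOcc s p r b
  | r, imp a b => SignedOcc s p r.flip a ∨ SignedOcc s p r b
  | r, box a => SignedOcc s p r a
  | r, dia a => SignedOcc s p r a
  | r, bdia a => SignedOcc s p r a
  | r, bbox a => SignedOcc s p r a

/-- `φ` is positive in `p`: every occurrence of `p` in the tree `+φ` is signed `+`. -/
def PositiveIn (p : P) (φ : MForm P N) : Prop := ¬ SignedOcc .neg p .pos φ

/-- `φ` is negative in `p`: every occurrence of `p` in the tree `+φ` is signed `-`. -/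
def NegativeIn (p : P) (φ : MForm P N) : Prop := ¬ SignedOcc .pos p .pos φ

/-- Replacement of every occurrence of `p` by `θ`. -/
def subst [DecidableEq P] (p : P) (θ : MForm P N) : MForm P N → MForm P N
  | prop q => if q = p then θ else prop q
  | nom i => nom i
  | top => top
  | bot => bot
  | neg a => neg (subst p θ a)
  | and a b => and (subst p θ a) (subst p θ b)
  | or a b => or (subst p θ a) (subst p θ b)
  | imp a b => imp (subst p θ a) (subst p θ b)
  | box a => box (subst p θ a)
  | dia a => dia (subst p θ a)
  | bdia a => bdia (subst p θ a)
  | bbox a => bbox (subst p θ a)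

/-- A pure formula, that is, a formula over the empty set of propositional variables, regarded as
a formula over `P`. -/
def ofPure : MForm Empty N → MForm P N
  | prop q => q.elim
  | nom i => nom i
  | top => top
  | bot => bot
  | neg a => neg (ofPure a)
  | and a b => and (ofPure a) (ofPure b)
  | or a b => or (ofPure a) (ofPure b)
  | imp a b => imp (ofPure a) (ofPure b)
  | box a => box (ofPure a)
  | dia a => dia (ofPure a)
  | bdia a => bdia (ofPure a)
  | bbox a => bbox (ofPure a)

/-- The finite join `⋁ αᵢ` of a list of formulas (`⊥` for the empty list). -/
def bigOr : List (MForm P N) → MForm P N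
  | [] => bot
  | [a] => a
  | a :: b :: l => or a (bigOr (b :: l))

/-- The finite meet `⋀ αᵢ` of a list of formulas (`⊤` for the empty list). -/
def bigAnd : List (MForm P N) → MForm P N
  | [] => top
  | [a] => a
  | a :: b :: l => and a (bigAnd (b :: l))

end MForm

/-! ## Contexts with one hole -/

/-- `φ(!x)` with exactly one occurrence of the placeholder `x` (the `hole`), which is not in the
scope of a black connective. -/
inductive Ctx (P : Type u) (N : Type v) : Type (max u v)
  | hole : Ctx P N
  | neg (C : Ctx P N) : Ctx P N
  | andL (C : Ctx P N) (b : MForm P N) : Ctx P N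
  | andR (a : MForm P N) (C : Ctx P N) : Ctx P N
  | orL (C : Ctx P N) (b : MForm P N) : Ctx P N
  | orR (a : MForm P N) (C : Ctx P N) : Ctx P N
  | impL (C : Ctx P N) (b : MForm P N) : Ctx P N
  | impR (a : MForm P N) (C : Ctx P N) : Ctx P N
  | box (C : Ctx P N) : Ctx P N
  | dia (C : Ctx P N) : Ctx P N

namespace Ctx

variable {P : Type u} {N : Type v}

/-- `φ(γ/!x)`. -/
def fill : Ctx P N → MForm P N → MForm P N
  | hole, γ => γ
  | neg C, γ => .neg (C.fill γ)
  | andL C b, γ => .and (C.fill γ) b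
  | andR a C, γ => .and a (C.fill γ)
  | orL C b, γ => .or (C.fill γ) b
  | orR a C, γ => .or a (C.fill γ)
  | impL C b, γ => .imp (C.fill γ) b
  | impR a C, γ => .imp a (C.fill γ)
  | box C, γ => .box (C.fill γ)
  | dia C, γ => .dia (C.fill γ)

/-- The sign received by the placeholder when the root is signed `r`. -/
def holeSign : Ctx P N → Sign → Sign
  | hole, r => r
  | neg C, r => C.holeSign r.flip
  | andL C _, r => C.holeSign r
  | andR _ C, r => C.holeSign r
  | orL C _, r => C.holeSign r
  | orR _ C, r => C.holeSign r
  | impL C _, r => C.holeSign r.flip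
  | impR _ C, r => C.holeSign r
  | box C, r => C.holeSign r
  | dia C, r => C.holeSign r

/-- With the root signed `r`, every node on the branch from the root to the placeholder (the
placeholder itself excepted) is SLR, i.e. one of `+∧, +◇, +¬, -∨, -□, -¬, -→`. -/
def IsSLR : Ctx P N → Sign → Prop
  | hole, _ => True
  | neg C, r => C.IsSLR r.flip
  | andL C _, r => r = .pos ∧ C.IsSLR r
  | andR _ C, r => r = .pos ∧ C.IsSLR r
  | orL C _, r => r = .neg ∧ C.IsSLR r
  | orR _ C, r => r = .neg ∧ C.IsSLR r
  | impL C _, r => r = .neg ∧ C.IsSLR r.flip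
  | impR _ C, r => r = .neg ∧ C.IsSLR r
  | box C, r => r = .neg ∧ C.IsSLR r
  | dia C, r => r = .pos ∧ C.IsSLR r

end Ctx

/-! ## Possibility frames -/

section Downset

variable {W : Type w} [PartialOrder W]

/-- Closure in the downset topology (`⊑` is written `≤`). -/
def cl (X : Set W) : Set W := {x | ∃ y, y ≤ x ∧ y ∈ X}

/-- Interior in the downset topology. -/
def int (X : Set W) : Set W := {x | ∀ y, y ≤ x → y ∈ X}

/-- Regular open sets of the downset topology. -/
def IsRO (X : Set W) : Prop := int (cl X) = X

/-- The regular open closure: the least regular open set that contains `X`. -/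
def ro (X : Set W) : Set W := ⋂₀ {Y | IsRO Y ∧ X ⊆ Y}

end Downset

/-- A possibility frame `(W, ⊑, R, P)` with domain `W` and refinement relation `≤`. The admissible
sets form a sub-Boolean algebra of the regular open sets that is closed under the box of `R`. -/
structure PossibilityFrame (W : Type w) [PartialOrder W] where
  nonempty : Nonempty W
  R : W → W → Prop
  admissible : Set (Set W)
  isRO_of_mem : ∀ X ∈ admissible, IsRO X
  empty_mem : ∅ ∈ admissible
  univ_mem : Set.univ ∈ admissible
  inter_mem : ∀ X ∈ admissible, ∀ Y ∈ admissible, X ∩ Y ∈ admissible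
  join_mem : ∀ X ∈ admissible, ∀ Y ∈ admissible, int (cl (X ∪ Y)) ∈ admissible
  compl_mem : ∀ X ∈ admissible, int Xᶜ ∈ admissible
  box_mem : ∀ X ∈ admissible, {x | ∀ y, R x y → y ∈ X} ∈ admissible

/-! ## The correspondence language and the regular open translation -/

/-- The non-logical relation symbols of the correspondence language: refinement `⊑`,
accessibility `R`, and a unary predicate for each propositional variable. -/
inductive CorrRel (Q : Type u) : ℕ → Type u
  | refines : CorrRel Q 2
  | acc : CorrRel Q 2
  | pred (q : Q) : CorrRel Q 1

/-- The first-order correspondence language over the propositional variables `Q`. Over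
`Q = Empty` only the two binary symbols remain. The individual symbols that
correspond to nominals are treated as (free) individual variables, so that they can be
quantified. -/
def corrLang (Q : Type u) : FirstOrder.Language.{0, u} := ⟨fun _ => Empty, CorrRel Q⟩

section Translation

variable {Q : Type u} {N : Type v} {n : ℕ}

/-- The relation symbol `⊑`. -/
def refSymb : (corrLang Q).Relations 2 := CorrRel.refines

/-- The relation symbol `R`. -/
def accSymb : (corrLang Q).Relations 2 := CorrRel.acc

/-- The unary predicate symbol of the propositional variable `q`. -/
def predSymb (q : Q) : (corrLang Q).Relations 1 := CorrRel.pred q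

/-- `x ⊑ y` for bound variables `x`, `y`. -/
def fRef (x y : Fin n) : (corrLang Q).BoundedFormula N n :=
  refSymb.boundedFormula₂ (Term.var (Sum.inr x)) (Term.var (Sum.inr y))

/-- `R x y` for bound variables `x`, `y`. -/
def fAcc (x y : Fin n) : (corrLang Q).BoundedFormula N n :=
  accSymb.boundedFormula₂ (Term.var (Sum.inr x)) (Term.var (Sum.inr y))

/-- `P_q x` for a bound variable `x`. -/
def fPred (q : Q) (x : Fin n) : (corrLang Q).BoundedFormula N n :=
  (predSymb q).boundedFormula₁ (Term.var (Sum.inr x))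

/-- `i = x` for the individual symbol `i` and a bound variable `x`. -/
def fEq (i : N) (x : Fin n) : (corrLang Q).BoundedFormula N n :=
  Term.bdEqual (Term.var (Sum.inl i)) (Term.var (Sum.inr x))

/-- `(∀ y ⊑ x) A(y)`; the variable `y` is `Fin.last n` in `A`. -/
def allBelow (x : Fin n) (A : (corrLang Q).BoundedFormula N (n + 1)) :
    (corrLang Q).BoundedFormula N n :=
  ((fRef (Fin.last n) x.castSucc).imp A).all

/-- `(∃ y ⊑ x) A(y)`. -/
def exBelow (x : Fin n) (A : (corrLang Q).BoundedFormula N (n + 1)) :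
    (corrLang Q).BoundedFormula N n :=
  (fRef (Fin.last n) x.castSucc ⊓ A).ex

/-- `(∀ y ⊒ x) A(y)`. -/
def allAbove (x : Fin n) (A : (corrLang Q).BoundedFormula N (n + 1)) :
    (corrLang Q).BoundedFormula N n :=
  ((fRef x.castSucc (Fin.last n)).imp A).all

/-- `(∃ y ⊒ x) A(y)`. -/
def exAbove (x : Fin n) (A : (corrLang Q).BoundedFormula N (n + 1)) :
    (corrLang Q).BoundedFormula N n :=
  (fRef x.castSucc (Fin.last n) ⊓ A).ex

/-- `∀ y (R x y → A(y))`. -/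
def allSucc (x : Fin n) (A : (corrLang Q).BoundedFormula N (n + 1)) :
    (corrLang Q).BoundedFormula N n :=
  ((fAcc x.castSucc (Fin.last n)).imp A).all

/-- `∃ y (R x y ∧ A(y))`. -/
def exSucc (x : Fin n) (A : (corrLang Q).BoundedFormula N (n + 1)) :
    (corrLang Q).BoundedFormula N n :=
  (fAcc x.castSucc (Fin.last n) ⊓ A).ex

/-- `∀ y (R y x → A(y))`. -/
def allPred (x : Fin n) (A : (corrLang Q).BoundedFormula N (n + 1)) :
    (corrLang Q).BoundedFormula N n :=
  ((fAcc (Fin.last n) x.castSucc).imp A).all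

/-- `∃ y (R y x ∧ A(y))`. -/
def exPred (x : Fin n) (A : (corrLang Q).BoundedFormula N (n + 1)) :
    (corrLang Q).BoundedFormula N n :=
  (fAcc (Fin.last n) x.castSucc ⊓ A).ex

/-- Syntactic regular open closure `(∀ y ⊑ x)(∃ z ⊑ y)(∃ z' ⊒ z) A(z')`; the variable `z'` is
`Fin.last (n + 2)` in `A`. -/
def roClosure (x : Fin n) (A : (corrLang Q).BoundedFormula N (n + 1 + 1 + 1)) :
    (corrLang Q).BoundedFormula N n :=
  allBelow x (exBelow (Fin.last n) (exAbove (Fin.last (n + 1)) A))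

/-- The regular open translation `ST_x(φ)`, where `x` is one of the `n` bound variables in
scope. -/
def ST : MForm Q N → {n : ℕ} → Fin n → (corrLang Q).BoundedFormula N n
  | .prop q, _, x => fPred q x
  | .nom i, n, x => roClosure x (fEq i (Fin.last (n + 2)))
  | .top, _, _ => ⊤
  | .bot, _, _ => ⊥
  | .neg a, n, x => allBelow x (ST a (Fin.last n)).not
  | .and a b, _, x => ST a x ⊓ ST b x
  | .or a b, n, x =>
      allBelow x (exBelow (Fin.last n) (ST a (Fin.last (n + 1)) ⊔ ST b (Fin.last (n + 1))))
  | .imp a b, n, x => allBelow x ((ST a (Fin.last n)).imp (ST b (Fin.last n)))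
  | .box a, n, x => allSucc x (ST a (Fin.last n))
  | .dia a, n, x =>
      allBelow x (exSucc (Fin.last n) (exBelow (Fin.last (n + 1)) (ST a (Fin.last (n + 2)))))
  | .bdia a, n, x => roClosure x (exPred (Fin.last (n + 2)) (ST a (Fin.last (n + 3))))
  | .bbox a, n, x =>
      allBelow x (allAbove (Fin.last n) (allPred (Fin.last (n + 1))
        (exBelow (Fin.last (n + 2)) (ST a (Fin.last (n + 3))))))

/-- `∀ x (ST_x(φ) → ST_x(ψ))`. -/
def Ineq.toFO (e : Ineq Q N) : (corrLang Q).Formula N :=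
  BoundedFormula.all ((ST e.lhs (Fin.last 0)).imp (ST e.rhs (Fin.last 0)))

/-- The translation of a quasi-inequality: the conjunction of the translated premises implies the
translated conclusion. The individual symbols of the nominals are left free. -/
noncomputable def System.toFO (s : System Q N) : (corrLang Q).Formula N :=
  (Formula.iInf fun e : s.prem => e.1.toFO).imp s.concl.toFO

/-- The universal closure `∀ j⃗ A` over the individual symbols that occur in `A`. -/
noncomputable def univClosure [DecidableEq N] (A : (corrLang Q).Formula N) :
    (corrLang Q).Sentence :=
  Formula.iAlls A.freeVarFinset (Formula.relabel Sum.inr (A.restrictFreeVar id))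

/-- The first-order output: the conjunction, over a list of pure systems, of the universally
closed translations. -/
noncomputable def FO [DecidableEq N] (l : List (System Empty N)) : (corrLang Empty).Sentence :=
  (l.map fun s => univClosure s.toFO).foldr (· ⊓ ·) ⊤

end Translation

/-! ## Semantics on possibility frames -/

namespace PossibilityFrame

variable {P : Type u} {N : Type v} {W : Type w} [PartialOrder W]

/-- All regular open sets are admissible. -/
def IsFull (F : PossibilityFrame W) : Prop := F.admissible = {X | IsRO X}

/-- The satisfaction relation. `V` interprets the propositional variables, `U` the nominals. -/
def Sat (F : PossibilityFrame W) (V : P → Set W) (U : N → Set W) : W → MForm P N → Prop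
  | x, .prop p => x ∈ V p
  | x, .nom i => x ∈ U i
  | _, .top => True
  | _, .bot => False
  | x, .neg a => ∀ y, y ≤ x → ¬ F.Sat V U y a
  | x, .and a b => F.Sat V U x a ∧ F.Sat V U x b
  | x, .or a b => ∀ y, y ≤ x → ∃ z, z ≤ y ∧ (F.Sat V U z a ∨ F.Sat V U z b)
  | x, .imp a b => ∀ y, y ≤ x → F.Sat V U y a → F.Sat V U y b
  | x, .box a => ∀ y, F.R x y → F.Sat V U y a
  | x, .dia a => ∀ y, y ≤ x → ∃ z, F.R y z ∧ ∃ t, t ≤ z ∧ F.Sat V U t a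
  | x, .bdia a => ∀ y, y ≤ x → ∃ z, z ≤ y ∧ ∃ t, z ≤ t ∧ ∃ s, F.R s t ∧ F.Sat V U s a
  | x, .bbox a => ∀ y, y ≤ x → ∀ z, y ≤ z → ∀ t, F.R t z → ∃ s, s ≤ t ∧ F.Sat V U s a

/-- Validity of an inequality: global truth under all interpretations of propositional variables
by admissible sets and of nominals by regular open closures of singletons. -/
def Valid (F : PossibilityFrame W) (e : Ineq P N) : Prop :=
  ∀ (V : P → Set W) (U : N → Set W), (∀ p, V p ∈ F.admissible) → (∀ i, ∃ x, U i = ro {x}) →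
    ∀ x, F.Sat V U x e.lhs → F.Sat V U x e.rhs

/-- A frame as a structure for the part of the correspondence language without unary
predicates. -/
@[reducible]
def toStructure (F : PossibilityFrame W) : (corrLang Empty).Structure W where
  funMap := fun f _ => Empty.elim f
  RelMap := fun r =>
    match r with
    | .refines => fun xs => xs 0 ≤ xs 1
    | .acc => fun xs => F.R (xs 0) (xs 1)
    | .pred q => q.elim

/-- Truth of a first-order sentence in the symbols `⊑` and `R` on a frame. -/
def Models (F : PossibilityFrame W) (A : (corrLang Empty).Sentence) : Prop :=
  @Sentence.Realize (corrLang Empty) W F.toStructure A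

end PossibilityFrame

/-! ## The algorithm -/

section Algorithm

variable {P : Type u} {N : Type v}

/-- The local form of the distribution rules at a node of the given sign: the connective at that
node is distributed over a child `+∨` or a child `-∧`. -/
inductive Distr : Sign → MForm P N → MForm P N → Prop
  | dia (a b) : Distr .pos (.dia (.or a b)) (.or (.dia a) (.dia b))
  | andL (a b c) : Distr .pos (.and (.or a b) c) (.or (.and a c) (.and b c))
  | andR (a b c) : Distr .pos (.and c (.or a b)) (.or (.and c a) (.and c b))
  | negOr (a b) : Distr .neg (.neg (.or a b)) (.and (.neg a) (.neg b))
  | impL (a b c) : Distr .neg (.imp (.or a b) c) (.and (.imp a c) (.imp b c))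
  | box (a b) : Distr .neg (.box (.and a b)) (.and (.box a) (.box b))
  | orL (a b c) : Distr .neg (.or (.and a b) c) (.and (.or a c) (.or b c))
  | orR (a b c) : Distr .neg (.or c (.and a b)) (.and (.or c a) (.or c b))
  | negAnd (a b) : Distr .pos (.neg (.and a b)) (.or (.neg a) (.neg b))
  | impR (a b c) : Distr .neg (.imp c (.and a b)) (.and (.imp c a) (.imp c b))

/-- The splitting rules. -/
inductive Split [DecidableEq P] [DecidableEq N] : Ineq P N → Finset (Ineq P N) → Prop
  | and (a b c) : Split ⟨a, .and b c⟩ {⟨a, b⟩, ⟨a, c⟩}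
  | or (a b c) : Split ⟨.or a b, c⟩ {⟨a, c⟩, ⟨b, c⟩}

/-- Replacement of `p` by `θ` on both sides of an inequality. -/
def Ineq.subst [DecidableEq P] (p : P) (θ : MForm P N) (e : Ineq P N) : Ineq P N :=
  ⟨MForm.subst p θ e.lhs, MForm.subst p θ e.rhs⟩

/-- The rules of the preprocessing stage, rewriting one inequality into one or two. -/
inductive PreRule [DecidableEq P] [DecidableEq N] : Ineq P N → Finset (Ineq P N) → Prop
  | distrL (C : Ctx P N) (a b ψ) : Distr (C.holeSign .pos) a b →
      PreRule ⟨C.fill a, ψ⟩ {⟨C.fill b, ψ⟩}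
  | distrR (C : Ctx P N) (a b φ) : Distr (C.holeSign .neg) a b →
      PreRule ⟨φ, C.fill a⟩ {⟨φ, C.fill b⟩}
  | elimBot (p : P) (α β) : α.NegativeIn p → β.PositiveIn p →
      PreRule ⟨α, β⟩ {Ineq.subst p .bot ⟨α, β⟩}
  | elimTop (p : P) (α β) : α.NegativeIn p → β.PositiveIn p →
      PreRule ⟨β, α⟩ {Ineq.subst p .top ⟨β, α⟩}
  | split (e T) : Split e T → PreRule e T

/-- One step of the preprocessing stage. -/
inductive PreStep [DecidableEq P] [DecidableEq N] :
    Finset (Ineq P N) → Finset (Ineq P N) → Prop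
  | mk (T : Finset (Ineq P N)) (e T') : e ∈ T → PreRule e T' → PreStep T (T.erase e ∪ T')

/-- The residuation rules. -/
inductive Resid : Ineq P N → Ineq P N → Prop
  | dia (c d) : Resid ⟨.dia c, d⟩ ⟨c, .bbox d⟩
  | negLeft (c d) : Resid ⟨.neg c, d⟩ ⟨.neg d, c⟩
  | box (c d) : Resid ⟨c, .box d⟩ ⟨.bdia c, d⟩
  | negRight (c d) : Resid ⟨c, .neg d⟩ ⟨d, .neg c⟩
  | and₁ (c d b) : Resid ⟨.and c d, b⟩ ⟨c, .imp d b⟩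
  | or₁ (c d b) : Resid ⟨c, .or d b⟩ ⟨.and c (.neg d), b⟩
  | and₂ (c d b) : Resid ⟨.and c d, b⟩ ⟨d, .imp c b⟩
  | or₂ (c d b) : Resid ⟨c, .or d b⟩ ⟨.and c (.neg b), d⟩
  | imp₁ (c d b) : Resid ⟨c, .imp d b⟩ ⟨.and c d, b⟩
  | imp₂ (c d b) : Resid ⟨c, .imp d b⟩ ⟨d, .imp c b⟩

/-- The propositional variable `p` occurs in an inequality. -/
def Ineq.Occ (p : P) (e : Ineq P N) : Prop := e.lhs.Occ p ∨ e.rhs.Occ p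

/-- The nominal `i` occurs in an inequality. -/
def Ineq.NomOcc (i : N) (e : Ineq P N) : Prop := e.lhs.NomOcc i ∨ e.rhs.NomOcc i

/-- The nominal `i` occurs in a system. -/
def System.NomOcc (i : N) (s : System P N) : Prop :=
  (∃ e ∈ s.prem, e.NomOcc i) ∨ s.concl.NomOcc i

/-- One step of the reduction and elimination stage. -/
inductive RedStep [DecidableEq P] [DecidableEq N] : System P N → System P N → Prop
  | approxLeftPos (S : Finset (Ineq P N)) (C : Ctx P N) (γ ψ : MForm P N) (i : N) :
      C.IsSLR .pos → C.holeSign .pos = .pos → γ.IsBasic →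
      ¬ System.NomOcc i ⟨S, ⟨C.fill γ, ψ⟩⟩ →
      RedStep ⟨S, ⟨C.fill γ, ψ⟩⟩ ⟨S ∪ {⟨.nom i, γ⟩}, ⟨C.fill (.nom i), ψ⟩⟩
  | approxLeftNeg (S : Finset (Ineq P N)) (C : Ctx P N) (γ ψ : MForm P N) (i : N) :
      C.IsSLR .pos → C.holeSign .pos = .neg → γ.IsBasic →
      ¬ System.NomOcc i ⟨S, ⟨C.fill γ, ψ⟩⟩ →
      RedStep ⟨S, ⟨C.fill γ, ψ⟩⟩ ⟨S ∪ {⟨γ, .neg (.nom i)⟩}, ⟨C.fill (.neg (.nom i)), ψ⟩⟩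
  | approxRightPos (S : Finset (Ineq P N)) (C : Ctx P N) (γ φ : MForm P N) (i : N) :
      C.IsSLR .neg → C.holeSign .neg = .pos → γ.IsBasic →
      ¬ System.NomOcc i ⟨S, ⟨φ, C.fill γ⟩⟩ →
      RedStep ⟨S, ⟨φ, C.fill γ⟩⟩ ⟨S ∪ {⟨.nom i, γ⟩}, ⟨φ, C.fill (.nom i)⟩⟩
  | approxRightNeg (S : Finset (Ineq P N)) (C : Ctx P N) (γ φ : MForm P N) (i : N) :
      C.IsSLR .neg → C.holeSign .neg = .neg → γ.IsBasic →
      ¬ System.NomOcc i ⟨S, ⟨φ, C.fill γ⟩⟩ →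
      RedStep ⟨S, ⟨φ, C.fill γ⟩⟩ ⟨S ∪ {⟨γ, .neg (.nom i)⟩}, ⟨φ, C.fill (.neg (.nom i))⟩⟩
  | resid (S : Finset (Ineq P N)) (c e e' : Ineq P N) :
      e ∈ S → Resid e e' → RedStep ⟨S, c⟩ ⟨S.erase e ∪ {e'}, c⟩
  | split (S : Finset (Ineq P N)) (c e : Ineq P N) (T : Finset (Ineq P N)) :
      e ∈ S → Split e T → RedStep ⟨S, c⟩ ⟨S.erase e ∪ T, c⟩
  | rightAckermann (p : P) (αs : List (MForm P N)) (B : Finset (Ineq P N)) (c : Ineq P N) :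
      (∀ α ∈ αs, ¬ α.Occ p) → ¬ c.Occ p →
      (∀ e ∈ B, e.lhs.PositiveIn p ∧ e.rhs.NegativeIn p) →
      RedStep ⟨(αs.map fun α => Ineq.mk α (.prop p)).toFinset ∪ B, c⟩
        ⟨B.image (Ineq.subst p (MForm.bigOr αs)), c⟩
  | leftAckermann (p : P) (αs : List (MForm P N)) (B : Finset (Ineq P N)) (c : Ineq P N) :
      (∀ α ∈ αs, ¬ α.Occ p) → ¬ c.Occ p →
      (∀ e ∈ B, e.lhs.NegativeIn p ∧ e.rhs.PositiveIn p) →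
      RedStep ⟨(αs.map fun α => Ineq.mk (.prop p) α).toFinset ∪ B, c⟩
        ⟨B.image (Ineq.subst p (MForm.bigAnd αs)), c⟩

/-- A pure system, regarded as a system over the propositional variables `P`. -/
def System.ofPure [DecidableEq P] [DecidableEq N] (s : System Empty N) : System P N :=
  ⟨s.prem.image fun e => ⟨e.lhs.ofPure, e.rhs.ofPure⟩, ⟨s.concl.lhs.ofPure, s.concl.rhs.ofPure⟩⟩

/-- Some run of ALBA on `e` succeeds and outputs the first-order sentence `A`: preprocessing
rewrites `{e}` to the inequalities listed in `l`; from each of them, taken with an empty set of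
premises, the reduction stage reaches a pure system in the list `sys`; and `A` is the first-order
output of these pure systems. Runs need not apply preprocessing exhaustively or approximation
pivotally; runs that do are among those considered. -/
def Outputs [DecidableEq P] [DecidableEq N] (e : Ineq P N)
    (A : (corrLang Empty).Sentence) : Prop :=
  ∃ (l : List (Ineq P N)) (sys : List (System Empty N)),
    Relation.ReflTransGen PreStep {e} l.toFinset ∧
    List.Forall₂ (fun e' s => Relation.ReflTransGen RedStep ⟨∅, e'⟩ (System.ofPure s)) l sys ∧
    A = FO sys

end Algorithm

end PossALBA

/-!
A regular open set is a regular element of the Heyting algebra of lower sets, so the regular open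
sets form a Boolean algebra. On a full frame `□` and `◆` are adjoint operators on this algebra, and
the sets `ro {w}` that interpret the nominals are join-dense in it. Distribution, splitting and
residuation then express identities and adjunctions, and a variable of uniform sign is eliminated
by monotonicity. An approximation rule is sound because the operation denoted by an SLR context is
residuated: for it to lie below a bound at `γ` it suffices that it does so at each nominal below
`γ`. An Ackermann rule is sound because the join of the `αᵢ` is the least value of `p` with
`αᵢ ≤ p`, and monotonicity reduces the remaining premises at an arbitrary such value to those at
this join; the other rule is dual. So every step of a run preserves validity, and validity of the
pure systems reached at the end is expressed by their first-order translation.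
-/

namespace PossALBA

open Function

namespace Sign

section Le

variable {α β : Type*}

/-- The order read off a signed node: `≤` under the sign `+` and `≥` under the sign `-`. It lets
the two halves of each pair of dual rules be treated at once. -/
def Le [LE α] : Sign → α → α → Prop
  | pos, a, b => a ≤ b
  | neg, a, b => b ≤ a

lemma Le.refl [Preorder α] (s : Sign) (a : α) : s.Le a a := by
  cases s <;> exact le_rfl

lemma Le.trans [Preorder α] {s : Sign} {a b c : α} (hab : s.Le a b) (hbc : s.Le b c) :
    s.Le a c := by
  cases s
  · exact le_trans hab hbc
  · exact le_trans hbc hab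

lemma Le.map [Preorder α] [Preorder β] {f : α → β} (hf : Monotone f) {s : Sign} {a b : α}
    (h : s.Le a b) : s.Le (f a) (f b) := by
  cases s <;> exact hf h

lemma Le.inf [SemilatticeInf α] {s : Sign} {a b c d : α} (hab : s.Le a b) (hcd : s.Le c d) :
    s.Le (a ⊓ c) (b ⊓ d) := by
  cases s <;> exact inf_le_inf hab hcd

lemma Le.sup [SemilatticeSup α] {s : Sign} {a b c d : α} (hab : s.Le a b) (hcd : s.Le c d) :
    s.Le (a ⊔ c) (b ⊔ d) := by
  cases s <;> exact sup_le_sup hab hcd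

lemma Le.himp [GeneralizedHeytingAlgebra α] {s : Sign} {a b c d : α} (hab : s.flip.Le a b)
    (hcd : s.Le c d) : s.Le (a ⇨ c) (b ⇨ d) := by
  cases s <;> exact himp_le_himp hab hcd

lemma Le.compl [HeytingAlgebra α] {s : Sign} {a b : α} (h : s.flip.Le a b) : s.Le aᶜ bᶜ := by
  cases s <;> exact compl_le_compl h

lemma compl_le_iff [BooleanAlgebra α] {s : Sign} {a b : α} : s.Le aᶜ b ↔ s.flip.Le a bᶜ := by
  cases s
  · exact compl_le_iff_compl_le
  · exact le_compl_comm

end Le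

lemma eq_of_ne_flip {r s : Sign} (h : r ≠ s.flip) : r = s := by
  cases r <;> cases s <;> simp_all [flip]

section Formula

variable {P N : Type*}

/-- The inequality `a ≤ b` for the sign `+` and `b ≤ a` for the sign `-`. -/
def ineq : Sign → MForm P N → MForm P N → Ineq P N
  | pos, a, b => ⟨a, b⟩
  | neg, a, b => ⟨b, a⟩

/-- The formula put in place of a placeholder of the given sign by the approximation rules. -/
def nominal : Sign → N → MForm P N
  | pos, i => .nom i
  | neg, i => .neg (.nom i)

lemma nomOcc_ineq {s : Sign} {a b : MForm P N} {i : N} :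
    (s.ineq a b).NomOcc i ↔ a.NomOcc i ∨ b.NomOcc i := by
  cases s
  · exact Iff.rfl
  · exact or_comm

end Formula

end Sign

namespace Ctx

variable {P N : Type*}

lemma nomOcc_fill {i : N} {γ : MForm P N} (h : γ.NomOcc i) (C : Ctx P N) :
    (C.fill γ).NomOcc i := by
  induction C <;> simp_all [fill, MForm.NomOcc]

end Ctx

lemma forall_mem_iff_forall_mem_erase_union {α : Type*} [DecidableEq α] {S T : Finset α} {a : α}
    {p : α → Prop} (ha : a ∈ S) (hT : p a ↔ ∀ b ∈ T, p b) :
    (∀ b ∈ S, p b) ↔ ∀ b ∈ S.erase a ∪ T, p b := by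
  rw [Finset.forall_mem_union, ← hT, and_comm, ← Finset.forall_mem_insert, Finset.insert_erase ha]

lemma iff_of_reflTransGen {α : Type*} {r : α → α → Prop} {p : α → Prop}
    {a b : α} (h : Relation.ReflTransGen r a b) (hr : ∀ a b, r a b → (p a ↔ p b)) :
    p a ↔ p b := by
  induction h with
  | refl => rfl
  | tail _ hbc ih => exact ih.trans (hr _ _ hbc)

/-- A Boolean algebra with the operators that interpret `□` and `◆`, which are adjoint, and a
join-dense family of elements, which interpret the nominals. It abstracts from the regular open
sets of a full possibility frame. The interpretations of `◇` and `■` are the duals. -/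
structure HybridAlgebra (B ι : Type*) [BooleanAlgebra B] where
  box : B → B
  bdia : B → B
  gc : GaloisConnection bdia box
  point : ι → B
  point_dense : ∀ a b, (∀ w, point w ≤ a → point w ≤ b) → a ≤ b

namespace HybridAlgebra

variable {B ι P N : Type*} [BooleanAlgebra B] (H : HybridAlgebra B ι)

/-- The interpretation of `◇`. -/
def dia (a : B) : B := (H.box aᶜ)ᶜ

/-- The interpretation of `■`. -/
def bbox (a : B) : B := (H.bdia aᶜ)ᶜ

lemma gc_dia_bbox : GaloisConnection H.dia H.bbox := fun a b => by
  rw [dia, bbox, compl_le_iff_compl_le, le_compl_comm, H.gc.le_iff_le]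

/-- The interpretation, at an occurrence of the sign `s`, of the nominal named by `w`. -/
def signedPoint : Sign → ι → B
  | .pos, w => H.point w
  | .neg, w => (H.point w)ᶜ

lemma le_of_forall_signedPoint {s : Sign} {a b : B}
    (h : ∀ w, s.Le (H.signedPoint s w) a → s.Le (H.signedPoint s w) b) : s.Le a b := by
  cases s
  · exact H.point_dense a b h
  · refine compl_le_compl_iff_le.mp (H.point_dense aᶜ bᶜ fun w hw => ?_)
    exact le_compl_comm.mp (h w (le_compl_comm.mp hw))

/-! ### Formulas -/

/-- The value of a formula under a valuation of the propositional variables in the algebra and an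
assignment of points to the nominals. -/
def eval (v : P → B) (u : N → ι) : MForm P N → B
  | .prop p => v p
  | .nom i => H.point (u i)
  | .top => ⊤
  | .bot => ⊥
  | .neg a => (eval v u a)ᶜ
  | .and a b => eval v u a ⊓ eval v u b
  | .or a b => eval v u a ⊔ eval v u b
  | .imp a b => eval v u a ⇨ eval v u b
  | .box a => H.box (eval v u a)
  | .dia a => H.dia (eval v u a)
  | .bdia a => H.bdia (eval v u a)
  | .bbox a => H.bbox (eval v u a)

/-- The unary operation on the algebra that a context denotes. -/
def evalCtx (v : P → B) (u : N → ι) : Ctx P N → B → B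
  | .hole, x => x
  | .neg C, x => (evalCtx v u C x)ᶜ
  | .andL C b, x => evalCtx v u C x ⊓ H.eval v u b
  | .andR a C, x => H.eval v u a ⊓ evalCtx v u C x
  | .orL C b, x => evalCtx v u C x ⊔ H.eval v u b
  | .orR a C, x => H.eval v u a ⊔ evalCtx v u C x
  | .impL C b, x => evalCtx v u C x ⇨ H.eval v u b
  | .impR a C, x => H.eval v u a ⇨ evalCtx v u C x
  | .box C, x => H.box (evalCtx v u C x)
  | .dia C, x => H.dia (evalCtx v u C x)

variable {v : P → B} {u : N → ι}

lemma eval_fill (C : Ctx P N) (γ : MForm P N) :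
    H.eval v u (C.fill γ) = H.evalCtx v u C (H.eval v u γ) := by
  induction C <;> simp_all only [Ctx.fill, eval, evalCtx]

lemma eval_nominal (s : Sign) (i : N) :
    H.eval v u (s.nominal i) = H.signedPoint s (u i) := by
  cases s <;> rfl

lemma eval_update_prop [DecidableEq P] {p : P} {φ : MForm P N} (h : ¬ φ.Occ p) (x : B) :
    H.eval (update v p x) u φ = H.eval v u φ := by
  induction φ <;> simp_all [MForm.Occ, eval]

lemma eval_update_nom [DecidableEq N] {i : N} {φ : MForm P N} (h : ¬ φ.NomOcc i) (w : ι) :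
    H.eval v (update u i w) φ = H.eval v u φ := by
  induction φ <;> simp_all [MForm.NomOcc, eval]

lemma evalCtx_update_nom [DecidableEq N] {i : N} {C : Ctx P N} {γ : MForm P N}
    (h : ¬ (C.fill γ).NomOcc i) (w : ι) (x : B) :
    H.evalCtx v (update u i w) C x = H.evalCtx v u C x := by
  induction C <;> simp_all [Ctx.fill, MForm.NomOcc, evalCtx, eval_update_nom]

lemma eval_subst [DecidableEq P] (p : P) (θ φ : MForm P N) :
    H.eval v u (MForm.subst p θ φ) = H.eval (update v p (H.eval v u θ)) u φ := by
  induction φ with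
  | prop q => by_cases hq : q = p <;> simp [MForm.subst, eval, hq]
  | _ => simp_all [MForm.subst, eval]

lemma eval_update_le_eval_update [DecidableEq P] {p : P} {s : Sign} {x y : B} (hxy : s.Le x y)
    {r : Sign} {φ : MForm P N} (h : ¬ MForm.SignedOcc s.flip p r φ) :
    r.Le (H.eval (update v p x) u φ) (H.eval (update v p y) u φ) := by
  induction φ generalizing r with
  | prop q =>
    by_cases hq : q = p
    · obtain rfl : r = s := Sign.eq_of_ne_flip fun hr => h ⟨hq, hr⟩
      simpa [eval, hq] using hxy
    · simpa [eval, hq] using Sign.Le.refl r (v q)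
  | nom | top | bot => exact .refl r _
  | neg a iha => exact .compl (iha h)
  | and a b iha ihb => exact .inf (iha (mt .inl h)) (ihb (mt .inr h))
  | or a b iha ihb => exact .sup (iha (mt .inl h)) (ihb (mt .inr h))
  | imp a b iha ihb => exact .himp (iha (mt .inl h)) (ihb (mt .inr h))
  | box a iha => exact .map H.gc.monotone_u (iha h)
  | dia a iha => exact .map H.gc_dia_bbox.monotone_l (iha h)
  | bdia a iha => exact .map H.gc.monotone_l (iha h)
  | bbox a iha => exact .map H.gc_dia_bbox.monotone_u (iha h)

lemma eval_eq_of_distr {s : Sign} {a b : MForm P N} (h : Distr s a b) :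
    H.eval v u a = H.eval v u b := by
  cases h with
  | dia a b => exact H.gc_dia_bbox.l_sup
  | andL a b c => exact inf_sup_right _ _ _
  | andR a b c => exact inf_sup_left _ _ _
  | negOr a b => exact compl_sup
  | negAnd a b => exact compl_inf
  | impL a b c => exact sup_himp_distrib _ _ _
  | impR a b c => exact himp_inf_distrib _ _ _
  | box a b => exact H.gc.u_inf
  | orL a b c => exact sup_inf_right _ _ _
  | orR a b c => exact sup_inf_left _ _ _

lemma eval_bigOr_le_iff {αs : List (MForm P N)} {x : B} :
    H.eval v u (MForm.bigOr αs) ≤ x ↔ ∀ α ∈ αs, H.eval v u α ≤ x := by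
  induction αs using MForm.bigOr.induct <;> simp_all [MForm.bigOr, eval]

lemma le_eval_bigAnd_iff {αs : List (MForm P N)} {x : B} :
    x ≤ H.eval v u (MForm.bigAnd αs) ↔ ∀ α ∈ αs, x ≤ H.eval v u α := by
  induction αs using MForm.bigAnd.induct <;> simp_all [MForm.bigAnd, eval]

lemma exists_residual_of_isSLR {C : Ctx P N} {r : Sign} (hC : C.IsSLR r) :
    ∃ g : B → B, ∀ x b, r.Le (H.evalCtx v u C x) b ↔ (C.holeSign r).Le x (g b) := by
  induction C generalizing r with
  | hole => exact ⟨id, fun _ _ => Iff.rfl⟩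
  | neg C ih =>
    obtain ⟨g, hg⟩ := ih hC
    exact ⟨fun b => g bᶜ, fun x b => Sign.compl_le_iff.trans (hg x bᶜ)⟩
  | andL C a ih =>
    obtain ⟨rfl, hC⟩ := hC
    obtain ⟨g, hg⟩ := ih hC
    exact ⟨fun b => g (H.eval v u a ⇨ b), fun x b => le_himp_iff.symm.trans (hg x _)⟩
  | andR a C ih =>
    obtain ⟨rfl, hC⟩ := hC
    obtain ⟨g, hg⟩ := ih hC
    exact ⟨fun b => g (H.eval v u a ⇨ b), fun x b => le_himp_iff'.symm.trans (hg x _)⟩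
  | orL C a ih =>
    obtain ⟨rfl, hC⟩ := hC
    obtain ⟨g, hg⟩ := ih hC
    exact ⟨fun b => g (b \ H.eval v u a), fun x b => sdiff_le_iff'.symm.trans (hg x _)⟩
  | orR a C ih =>
    obtain ⟨rfl, hC⟩ := hC
    obtain ⟨g, hg⟩ := ih hC
    exact ⟨fun b => g (b \ H.eval v u a), fun x b => sdiff_le_iff.symm.trans (hg x _)⟩
  | impL C a ih =>
    obtain ⟨rfl, hC⟩ := hC
    obtain ⟨g, hg⟩ := ih hC
    exact ⟨fun b => g (b ⇨ H.eval v u a), fun x b => le_himp_comm.trans (hg x _)⟩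
  | impR a C ih =>
    obtain ⟨rfl, hC⟩ := hC
    obtain ⟨g, hg⟩ := ih hC
    exact ⟨fun b => g (b ⊓ H.eval v u a), fun x b => le_himp_iff.trans (hg x _)⟩
  | box C ih =>
    obtain ⟨rfl, hC⟩ := hC
    obtain ⟨g, hg⟩ := ih hC
    exact ⟨fun b => g (H.bdia b), fun x b => (H.gc b _).symm.trans (hg x _)⟩
  | dia C ih =>
    obtain ⟨rfl, hC⟩ := hC
    obtain ⟨g, hg⟩ := ih hC
    exact ⟨fun b => g (H.bbox b), fun x b => (H.gc_dia_bbox _ b).trans (hg x _)⟩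

/-! ### Inequalities -/

/-- Truth of an inequality under a valuation and an assignment. -/
def Holds (v : P → B) (u : N → ι) (e : Ineq P N) : Prop := H.eval v u e.lhs ≤ H.eval v u e.rhs

/-- Truth of an inequality under all valuations and assignments. -/
def Valid (e : Ineq P N) : Prop := ∀ (v : P → B) (u : N → ι), H.Holds v u e

/-- Truth of the quasi-inequality that a system stands for under all valuations and assignments. -/
def ValidSystem (s : System P N) : Prop :=
  ∀ (v : P → B) (u : N → ι), (∀ e ∈ s.prem, H.Holds v u e) → H.Holds v u s.concl

lemma holds_ineq {s : Sign} {a b : MForm P N} :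
    H.Holds v u (s.ineq a b) ↔ s.Le (H.eval v u a) (H.eval v u b) := by
  cases s <;> exact Iff.rfl

lemma holds_update_prop [DecidableEq P] {p : P} {e : Ineq P N} (h : ¬ e.Occ p) (x : B) :
    H.Holds (update v p x) u e ↔ H.Holds v u e := by
  rw [Holds, Holds, H.eval_update_prop (mt .inl h), H.eval_update_prop (mt .inr h)]

lemma holds_update_nom [DecidableEq N] {i : N} {e : Ineq P N} (h : ¬ e.NomOcc i) (w : ι) :
    H.Holds v (update u i w) e ↔ H.Holds v u e := by
  rw [Holds, Holds, H.eval_update_nom (mt .inl h), H.eval_update_nom (mt .inr h)]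

lemma holds_subst [DecidableEq P] (p : P) (θ : MForm P N) (e : Ineq P N) :
    H.Holds v u (e.subst p θ) ↔ H.Holds (update v p (H.eval v u θ)) u e := by
  rw [Holds, Holds, Ineq.subst, eval_subst, eval_subst]

lemma Holds.of_update [DecidableEq P] {p : P} {s : Sign} {x y : B} {e : Ineq P N}
    (hy : H.Holds (update v p y) u e) (hxy : s.Le x y)
    (hl : ¬ MForm.SignedOcc s.flip p .pos e.lhs) (hr : ¬ MForm.SignedOcc s p .pos e.rhs) :
    H.Holds (update v p x) u e := by
  have hyx : s.flip.Le y x := by cases s <;> exact hxy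
  have hr' : ¬ MForm.SignedOcc s.flip.flip p .pos e.rhs := by cases s <;> exact hr
  calc H.eval (update v p x) u e.lhs ≤ H.eval (update v p y) u e.lhs :=
        H.eval_update_le_eval_update hxy hl
    _ ≤ H.eval (update v p y) u e.rhs := hy
    _ ≤ H.eval (update v p x) u e.rhs := H.eval_update_le_eval_update hyx hr'

lemma holds_split [DecidableEq P] [DecidableEq N] {e : Ineq P N} {T : Finset (Ineq P N)}
    (h : Split e T) : H.Holds v u e ↔ ∀ f ∈ T, H.Holds v u f := by
  cases h <;> simp [Holds, eval]

lemma holds_resid {e f : Ineq P N} (h : Resid e f) : H.Holds v u e ↔ H.Holds v u f := by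
  cases h with
  | dia c d => exact H.gc_dia_bbox _ _
  | negLeft c d => exact compl_le_iff_compl_le
  | box c d => exact (H.gc _ _).symm
  | negRight c d => exact le_compl_comm
  | and₁ c d b => exact le_himp_iff.symm
  | and₂ c d b => exact le_himp_iff'.symm
  | or₁ c d b => exact sdiff_le_iff.symm.trans (by rw [sdiff_eq]; rfl)
  | or₂ c d b => exact sdiff_le_iff'.symm.trans (by rw [sdiff_eq]; rfl)
  | imp₁ c d b => exact le_himp_iff
  | imp₂ c d b => exact le_himp_comm

lemma validSystem_empty (e : Ineq P N) : H.ValidSystem ⟨∅, e⟩ ↔ H.Valid e := by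
  simp [ValidSystem, Valid]

/-! ### Soundness of the rules -/

lemma valid_fill_congr {C : Ctx P N} {r : Sign} {a b χ : MForm P N}
    (h : Distr (C.holeSign r) a b) :
    H.Valid (r.ineq (C.fill a) χ) ↔ H.Valid (r.ineq (C.fill b) χ) := by
  simp only [Valid, holds_ineq, eval_fill, H.eval_eq_of_distr h]

lemma valid_subst_iff [DecidableEq P] {p : P} {s : Sign} {θ : MForm P N} {e : Ineq P N}
    (hl : ¬ MForm.SignedOcc s.flip p .pos e.lhs) (hr : ¬ MForm.SignedOcc s p .pos e.rhs)
    (hθ : ∀ (v : P → B) (u : N → ι) (x : B), s.Le x (H.eval v u θ)) :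
    H.Valid e ↔ H.Valid (e.subst p θ) := by
  refine ⟨fun h v u => (H.holds_subst p θ e).mpr (h _ u), fun h v u => ?_⟩
  rw [← update_eq_self p v]
  exact ((H.holds_subst p θ e).mp (h v u)).of_update H (hθ v u (v p)) hl hr

lemma valid_preRule [DecidableEq P] [DecidableEq N] {e : Ineq P N} {T : Finset (Ineq P N)}
    (h : PreRule e T) : H.Valid e ↔ ∀ f ∈ T, H.Valid f := by
  cases h with
  | distrL C a b χ h =>
    simp only [Finset.mem_singleton, forall_eq]
    exact H.valid_fill_congr (r := .pos) h
  | distrR C a b χ h =>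
    simp only [Finset.mem_singleton, forall_eq]
    exact H.valid_fill_congr (r := .neg) h
  | elimBot p α β hα hβ =>
    simp only [Finset.mem_singleton, forall_eq]
    exact H.valid_subst_iff (s := .neg) hα hβ fun _ _ _ => bot_le
  | elimTop p α β hα hβ =>
    simp only [Finset.mem_singleton, forall_eq]
    exact H.valid_subst_iff (s := .pos) hβ hα fun _ _ _ => le_top
  | split e T h =>
    simp only [Valid, H.holds_split h]
    exact ⟨fun h f hf v u => h v u f hf, fun h v u f hf => h f hf v u⟩

lemma validSystem_replace [DecidableEq P] [DecidableEq N] {S T : Finset (Ineq P N)}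
    {c e : Ineq P N} (he : e ∈ S)
    (h : ∀ (v : P → B) (u : N → ι), H.Holds v u e ↔ ∀ f ∈ T, H.Holds v u f) :
    H.ValidSystem ⟨S, c⟩ ↔ H.ValidSystem ⟨S.erase e ∪ T, c⟩ := by
  simp only [ValidSystem, forall_mem_iff_forall_mem_erase_union he (h _ _)]

lemma validSystem_approx [DecidableEq P] [DecidableEq N] {S : Finset (Ineq P N)} {C : Ctx P N}
    {r s : Sign} {γ χ : MForm P N} {i : N} (hC : C.IsSLR r) (hs : C.holeSign r = s)
    (hi : ¬ System.NomOcc i ⟨S, r.ineq (C.fill γ) χ⟩) :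
    H.ValidSystem ⟨S, r.ineq (C.fill γ) χ⟩ ↔
      H.ValidSystem ⟨S ∪ {s.ineq (s.nominal i) γ}, r.ineq (C.fill (s.nominal i)) χ⟩ := by
  subst hs
  simp only [System.NomOcc, Sign.nomOcc_ineq, not_or, not_exists, not_and] at hi
  obtain ⟨hS, hCγ, hχ⟩ := hi
  have hγ : ¬ γ.NomOcc i := fun h => hCγ (Ctx.nomOcc_fill h C)
  simp only [ValidSystem, Finset.forall_mem_union, Finset.mem_singleton, forall_eq,
    holds_ineq, eval_fill, eval_nominal]
  refine ⟨fun h v u ⟨hv, hiγ⟩ => ?_, fun h v u hv => ?_⟩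
  · obtain ⟨g, hg⟩ := H.exists_residual_of_isSLR (v := v) (u := u) hC
    rw [hg]
    exact hiγ.trans ((hg _ _).mp (h v u hv))
  · obtain ⟨g, hg⟩ := H.exists_residual_of_isSLR (v := v) (u := u) hC
    rw [hg]
    refine H.le_of_forall_signedPoint fun w hw => ?_
    have hw' := h v (update u i w)
    simp only [update_self, H.eval_update_nom hγ, H.eval_update_nom hχ,
      H.evalCtx_update_nom hCγ, hg] at hw'
    exact hw' ⟨fun e he => (H.holds_update_nom (hS e he) w).mpr (hv e he), hw⟩

lemma validSystem_ackermann [DecidableEq P] [DecidableEq N] {s : Sign} {p : P}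
    {αs : List (MForm P N)} {S : Finset (Ineq P N)} {c : Ineq P N} {θ : MForm P N}
    (hα : ∀ α ∈ αs, ¬ α.Occ p) (hc : ¬ c.Occ p)
    (hS : ∀ e ∈ S, ¬ MForm.SignedOcc s.flip p .pos e.lhs ∧ ¬ MForm.SignedOcc s p .pos e.rhs)
    (hθ : ∀ (v : P → B) (u : N → ι) (x : B),
      s.Le (H.eval v u θ) x ↔ ∀ α ∈ αs, s.Le (H.eval v u α) x) :
    H.ValidSystem ⟨(αs.map fun α => s.ineq α (.prop p)).toFinset ∪ S, c⟩ ↔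
      H.ValidSystem ⟨S.image (Ineq.subst p θ), c⟩ := by
  simp only [ValidSystem, Finset.forall_mem_union, Finset.forall_mem_image, List.mem_toFinset,
    List.forall_mem_map, holds_ineq, holds_subst, eval]
  refine ⟨fun h v u hv => ?_, fun h v u ⟨hvα, hv⟩ => h v u fun e he => ?_⟩
  · rw [← H.holds_update_prop hc (H.eval v u θ)]
    refine h _ u ⟨fun α hαs => ?_, fun e he => hv he⟩
    rw [H.eval_update_prop (hα α hαs), update_self]
    exact (hθ v u _).mp (.refl s _) α hαs
  · rw [← update_eq_self p v] at hv
    exact (hv e he).of_update H ((hθ v u (v p)).mpr hvα) (hS e he).1 (hS e he).2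

lemma validSystem_redStep [DecidableEq P] [DecidableEq N] {s t : System P N}
    (h : RedStep s t) : H.ValidSystem s ↔ H.ValidSystem t := by
  cases h with
  | approxLeftPos S C γ χ i hC hs _ hi =>
    exact H.validSystem_approx (r := .pos) (s := .pos) hC hs hi
  | approxLeftNeg S C γ χ i hC hs _ hi =>
    exact H.validSystem_approx (r := .pos) (s := .neg) hC hs hi
  | approxRightPos S C γ χ i hC hs _ hi =>
    exact H.validSystem_approx (r := .neg) (s := .pos) hC hs hi
  | approxRightNeg S C γ χ i hC hs _ hi =>
    exact H.validSystem_approx (r := .neg) (s := .neg) hC hs hi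
  | resid S c e f he hf =>
    exact H.validSystem_replace he fun v u => by
      simp only [Finset.mem_singleton, forall_eq, H.holds_resid hf]
  | split S c e T he hT => exact H.validSystem_replace he fun v u => H.holds_split hT
  | rightAckermann p αs S c hα hc hS =>
    exact H.validSystem_ackermann (s := .pos) hα hc hS fun _ _ _ => H.eval_bigOr_le_iff
  | leftAckermann p αs S c hα hc hS =>
    exact H.validSystem_ackermann (s := .neg) hα hc hS fun _ _ _ => H.le_eval_bigAnd_iff

lemma forall_valid_preStep [DecidableEq P] [DecidableEq N] {T T' : Finset (Ineq P N)}
    (h : PreStep T T') : (∀ e ∈ T, H.Valid e) ↔ ∀ e ∈ T', H.Valid e := by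
  cases h with
  | mk e T' he hT' => exact forall_mem_iff_forall_mem_erase_union he (H.valid_preRule hT')

theorem valid_iff_of_run [DecidableEq P] [DecidableEq N] {e : Ineq P N} {l : List (Ineq P N)}
    {sys : List (System Empty N)} (hl : Relation.ReflTransGen PreStep {e} l.toFinset)
    (hsys : List.Forall₂
      (fun f s => Relation.ReflTransGen RedStep ⟨∅, f⟩ (System.ofPure s)) l sys) :
    H.Valid e ↔ ∀ s ∈ sys, H.ValidSystem (System.ofPure s : System P N) := by
  have hpre : H.Valid e ↔ ∀ f ∈ l, H.Valid f := by
    simpa using iff_of_reflTransGen hl fun _ _ => H.forall_valid_preStep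
  rw [hpre]
  clear hpre hl
  induction hsys with
  | nil => simp
  | @cons f s _ _ hfs _ ih =>
    have hred : H.Valid f ↔ H.ValidSystem (System.ofPure s) :=
      (H.validSystem_empty f).symm.trans
        (iff_of_reflTransGen hfs fun _ _ => H.validSystem_redStep)
    simp only [List.forall_mem_cons, hred, ih]

end HybridAlgebra

/-! ### Regular open sets -/

section RegularOpen

variable {W : Type*}

section Preorder

variable [Preorder W] {a b : LowerSet W} {x : W}

lemma mem_himp : x ∈ a ⇨ b ↔ ∀ y ≤ x, y ∈ a → y ∈ b := by
  rw [← LowerSet.Iic_le, le_himp_iff]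
  exact ⟨fun h y hy ha => h ⟨hy, ha⟩, fun h y ⟨hy, ha⟩ => h y hy ha⟩

lemma mem_compl : x ∈ aᶜ ↔ ∀ y ≤ x, y ∉ a := by
  rw [← himp_bot, mem_himp]
  rfl

lemma mem_compl_compl : x ∈ aᶜᶜ ↔ ∀ y ≤ x, ∃ z ≤ y, z ∈ a := by
  simp only [mem_compl, not_forall, not_not, exists_prop]

end Preorder

variable [PartialOrder W]

/-- The Boolean algebra of regular open sets of the downset topology, whose open sets are the lower
sets: `int (cl X)` is the double pseudocomplement of a lower set `X`. -/
abbrev RegularOpen (W : Type*) [PartialOrder W] : Type _ := Heyting.Regular (LowerSet W)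

lemma isRO_coe_iff {a : LowerSet W} : IsRO (a : Set W) ↔ Heyting.IsRegular a := by
  rw [Heyting.IsRegular, ← SetLike.coe_set_eq]
  refine Eq.congr_left (Set.ext fun x => ?_)
  exact mem_compl_compl.symm

lemma RegularOpen.isRO (a : RegularOpen W) : IsRO (a.val : Set W) := isRO_coe_iff.mpr a.prop

lemma IsRO.isLowerSet {X : Set W} (h : IsRO X) : IsLowerSet X := by
  rw [← h]
  exact fun x y hyx hx z hzy => hx z (hzy.trans hyx)

/-- A regular open set as an element of the Boolean algebra. -/
def IsRO.toRegularOpen {X : Set W} (h : IsRO X) : RegularOpen W :=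
  ⟨⟨X, h.isLowerSet⟩, isRO_coe_iff.mp h⟩

/-- The regular open closure of a singleton. -/
def RegularOpen.point (w : W) : RegularOpen W := Heyting.Regular.toRegular (LowerSet.Iic w)

lemma RegularOpen.point_le_iff {w : W} {a : RegularOpen W} :
    RegularOpen.point w ≤ a ↔ w ∈ a.val :=
  (Heyting.Regular.gi.gc _ _).trans LowerSet.Iic_le

lemma RegularOpen.mem_point {w x : W} :
    x ∈ (RegularOpen.point w).val ↔ ∀ y ≤ x, ∃ z ≤ y, z ≤ w :=
  mem_compl_compl

lemma ro_singleton (w : W) : ro {w} = ((RegularOpen.point w).val : Set W) := by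
  refine Set.Subset.antisymm (Set.sInter_subset_of_mem ⟨RegularOpen.isRO _, ?_⟩)
    (Set.subset_sInter fun X ⟨hX, hw⟩ => ?_)
  · exact Set.singleton_subset_iff.mpr (RegularOpen.point_le_iff.mp le_rfl)
  · exact (RegularOpen.point_le_iff (a := hX.toRegularOpen)).mpr (hw rfl)

end RegularOpen

namespace PossibilityFrame

variable {W : Type*} [PartialOrder W] {F : PossibilityFrame W}

lemma IsFull.mem_admissible (hF : F.IsFull) {X : Set W} : X ∈ F.admissible ↔ IsRO X := by
  rw [hF, Set.mem_ofPred_eq]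

/-- The regular open sets of a full possibility frame as a hybrid algebra. -/
def IsFull.hybridAlgebra (hF : F.IsFull) : HybridAlgebra (RegularOpen W) W where
  box a := (F.isRO_of_mem _ (F.box_mem _ (hF.mem_admissible.mpr a.isRO))).toRegularOpen
  bdia a := Heyting.Regular.toRegular (lowerClosure {x | ∃ y ∈ a.val, F.R y x})
  gc a b := by
    refine (Heyting.Regular.gi.gc _ _).trans (lowerClosure_le.trans ?_)
    exact ⟨fun h y hy x hyx => h ⟨y, hy, hyx⟩, fun h x ⟨y, hy, hyx⟩ => h hy x hyx⟩
  point := RegularOpen.point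
  point_dense a b h := fun w hw =>
    RegularOpen.point_le_iff.mp (h w (RegularOpen.point_le_iff.mpr hw))

section HybridAlgebra

variable {P N : Type*} (hF : F.IsFull) {a : RegularOpen W} {x : W}

lemma IsFull.mem_box : x ∈ (hF.hybridAlgebra.box a).val ↔ ∀ y, F.R x y → y ∈ a.val := Iff.rfl

lemma IsFull.mem_dia : x ∈ (hF.hybridAlgebra.dia a).val ↔
    ∀ y ≤ x, ∃ z, F.R y z ∧ ∃ t ≤ z, t ∈ a.val := by
  simp only [HybridAlgebra.dia, Heyting.Regular.coe_compl, mem_compl, hF.mem_box, not_forall,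
    not_not, exists_prop]

lemma IsFull.mem_bdia : x ∈ (hF.hybridAlgebra.bdia a).val ↔
    ∀ y ≤ x, ∃ z ≤ y, ∃ t, z ≤ t ∧ ∃ s, F.R s t ∧ s ∈ a.val := by
  refine mem_compl_compl.trans ?_
  simp only [mem_lowerClosure, Set.mem_ofPred_eq]
  grind

lemma IsFull.mem_bbox : x ∈ (hF.hybridAlgebra.bbox a).val ↔
    ∀ y ≤ x, ∀ z, y ≤ z → ∀ t, F.R t z → ∃ s ≤ t, s ∈ a.val := by
  have h : (hF.hybridAlgebra.bbox a).val =
      (lowerClosure {x | ∃ y ∈ (a.val)ᶜ, F.R y x})ᶜ := compl_compl_compl _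
  simp only [h, mem_compl, mem_lowerClosure, Set.mem_ofPred_eq]
  grind

lemma IsFull.sat_iff_mem_eval {v : P → RegularOpen W} {u : N → W} {φ : MForm P N} :
    F.Sat (fun p => (v p).val) (fun i => ro {u i}) x φ ↔
      x ∈ (hF.hybridAlgebra.eval v u φ).val := by
  induction φ generalizing x with
  | prop p => exact Iff.rfl
  | nom i => rw [Sat, ro_singleton]; rfl
  | top => exact iff_of_true trivial trivial
  | bot => exact iff_of_false id id
  | neg a iha =>
    simp only [Sat, HybridAlgebra.eval, Heyting.Regular.coe_compl, mem_compl, iha]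
  | and a b iha ihb => exact and_congr iha ihb
  | or a b iha ihb =>
    simp only [Sat, HybridAlgebra.eval, Heyting.Regular.coe_sup, mem_compl_compl,
      LowerSet.mem_sup_iff, iha, ihb]
  | imp a b iha ihb =>
    simp only [Sat, HybridAlgebra.eval, Heyting.Regular.coe_himp, mem_himp, iha, ihb]
  | box a iha => simp only [Sat, HybridAlgebra.eval, hF.mem_box, iha]
  | dia a iha => simp only [Sat, HybridAlgebra.eval, hF.mem_dia, iha]
  | bdia a iha => simp only [Sat, HybridAlgebra.eval, hF.mem_bdia, iha]
  | bbox a iha => simp only [Sat, HybridAlgebra.eval, hF.mem_bbox, iha]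

lemma IsFull.holds_iff {v : P → RegularOpen W} {u : N → W} {e : Ineq P N} :
    hF.hybridAlgebra.Holds v u e ↔
      ∀ x, F.Sat (fun p => (v p).val) (fun i => ro {u i}) x e.lhs →
        F.Sat (fun p => (v p).val) (fun i => ro {u i}) x e.rhs := by
  simp only [hF.sat_iff_mem_eval]
  exact Iff.rfl

theorem IsFull.valid_iff {e : Ineq P N} : F.Valid e ↔ hF.hybridAlgebra.Valid e := by
  refine ⟨fun h v u => hF.holds_iff.mpr ?_, fun h V U hV hU => ?_⟩
  · exact h _ _ (fun p => hF.mem_admissible.mpr (v p).isRO) fun i => ⟨u i, rfl⟩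
  · choose u hu using hU
    obtain rfl : U = fun i => ro {u i} := funext hu
    exact hF.holds_iff.mp (h (fun p => (F.isRO_of_mem _ (hV p)).toRegularOpen) u)

end HybridAlgebra

end PossibilityFrame

/-! ### The first-order translation -/

open FirstOrder FirstOrder.Language

section Realize

variable {Q N M : Type*} [(corrLang Q).Structure M]

section BoundedQuantifiers

variable {n : ℕ} {v : N → M} {xs : Fin n → M} {x y : Fin n}
  {A : (corrLang Q).BoundedFormula N (n + 1)}

lemma realize_fRef : (fRef x y : (corrLang Q).BoundedFormula N n).Realize v xs ↔
    Structure.RelMap (refSymb : (corrLang Q).Relations 2) ![xs x, xs y] :=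
  BoundedFormula.realize_rel₂

lemma realize_fAcc : (fAcc x y : (corrLang Q).BoundedFormula N n).Realize v xs ↔
    Structure.RelMap (accSymb : (corrLang Q).Relations 2) ![xs x, xs y] :=
  BoundedFormula.realize_rel₂

lemma realize_fEq {i : N} :
    (fEq i x : (corrLang Q).BoundedFormula N n).Realize v xs ↔ v i = xs x :=
  BoundedFormula.realize_bdEqual _ _

lemma realize_allBelow : (allBelow x A).Realize v xs ↔ ∀ y,
    Structure.RelMap (refSymb : (corrLang Q).Relations 2) ![y, xs x] →
      A.Realize v (Fin.snoc xs y) := by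
  simp only [allBelow, BoundedFormula.realize_all, BoundedFormula.realize_imp, realize_fRef,
    Fin.snoc_last, Fin.snoc_castSucc]

lemma realize_exBelow : (exBelow x A).Realize v xs ↔ ∃ y,
    Structure.RelMap (refSymb : (corrLang Q).Relations 2) ![y, xs x] ∧
      A.Realize v (Fin.snoc xs y) := by
  simp only [exBelow, BoundedFormula.realize_ex, BoundedFormula.realize_inf, realize_fRef,
    Fin.snoc_last, Fin.snoc_castSucc]

lemma realize_allAbove : (allAbove x A).Realize v xs ↔ ∀ y,
    Structure.RelMap (refSymb : (corrLang Q).Relations 2) ![xs x, y] →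
      A.Realize v (Fin.snoc xs y) := by
  simp only [allAbove, BoundedFormula.realize_all, BoundedFormula.realize_imp, realize_fRef,
    Fin.snoc_last, Fin.snoc_castSucc]

lemma realize_exAbove : (exAbove x A).Realize v xs ↔ ∃ y,
    Structure.RelMap (refSymb : (corrLang Q).Relations 2) ![xs x, y] ∧
      A.Realize v (Fin.snoc xs y) := by
  simp only [exAbove, BoundedFormula.realize_ex, BoundedFormula.realize_inf, realize_fRef,
    Fin.snoc_last, Fin.snoc_castSucc]

lemma realize_allSucc : (allSucc x A).Realize v xs ↔ ∀ y,
    Structure.RelMap (accSymb : (corrLang Q).Relations 2) ![xs x, y] →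
      A.Realize v (Fin.snoc xs y) := by
  simp only [allSucc, BoundedFormula.realize_all, BoundedFormula.realize_imp, realize_fAcc,
    Fin.snoc_last, Fin.snoc_castSucc]

lemma realize_exSucc : (exSucc x A).Realize v xs ↔ ∃ y,
    Structure.RelMap (accSymb : (corrLang Q).Relations 2) ![xs x, y] ∧
      A.Realize v (Fin.snoc xs y) := by
  simp only [exSucc, BoundedFormula.realize_ex, BoundedFormula.realize_inf, realize_fAcc,
    Fin.snoc_last, Fin.snoc_castSucc]

lemma realize_allPred : (allPred x A).Realize v xs ↔ ∀ y,
    Structure.RelMap (accSymb : (corrLang Q).Relations 2) ![y, xs x] →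
      A.Realize v (Fin.snoc xs y) := by
  simp only [allPred, BoundedFormula.realize_all, BoundedFormula.realize_imp, realize_fAcc,
    Fin.snoc_last, Fin.snoc_castSucc]

lemma realize_exPred : (exPred x A).Realize v xs ↔ ∃ y,
    Structure.RelMap (accSymb : (corrLang Q).Relations 2) ![y, xs x] ∧
      A.Realize v (Fin.snoc xs y) := by
  simp only [exPred, BoundedFormula.realize_ex, BoundedFormula.realize_inf, realize_fAcc,
    Fin.snoc_last, Fin.snoc_castSucc]

end BoundedQuantifiers

lemma realize_univClosure [DecidableEq N] [Nonempty M] {A : (corrLang Q).Formula N} :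
    M ⊨ univClosure A ↔ ∀ v : N → M, A.Realize v := by
  simp only [univClosure, Sentence.Realize, Formula.realize_iAlls, Formula.realize_relabel]
  refine ⟨fun h v => ?_, fun h u => ?_⟩
  · exact (BoundedFormula.realize_restrictFreeVar (f := id) v fun _ => rfl).mp (h fun i => v i)
  · obtain ⟨v, rfl⟩ := Subtype.val_injective.surjective_comp_right u
    exact (BoundedFormula.realize_restrictFreeVar (f := id) v fun _ => rfl).mpr (h v)

end Realize

lemma mem_ro_singleton {W : Type*} [PartialOrder W] {w x : W} :
    x ∈ ro {w} ↔ ∀ y ≤ x, ∃ z ≤ y, ∃ t, z ≤ t ∧ w = t := by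
  simp only [ro_singleton, SetLike.mem_coe, RegularOpen.mem_point, exists_eq_right']

namespace PossibilityFrame

variable {P N W : Type*} [PartialOrder W] {F : PossibilityFrame W}

lemma realize_ST {V : P → Set W} {v : N → W} {φ : MForm Empty N} {n : ℕ} {xs : Fin n → W}
    {x : Fin n} :
    letI := F.toStructure
    (ST φ x).Realize v xs ↔ F.Sat V (fun i => ro {v i}) (xs x) φ.ofPure := by
  let := F.toStructure
  have relMap_refSymb (a b : W) :
      Structure.RelMap (refSymb : (corrLang Empty).Relations 2) ![a, b] ↔ a ≤ b := Iff.rfl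
  have relMap_accSymb (a b : W) :
      Structure.RelMap (accSymb : (corrLang Empty).Relations 2) ![a, b] ↔ F.R a b := Iff.rfl
  induction φ generalizing n with
  | prop q => exact q.elim
  | nom i =>
    simp only [ST, roClosure, MForm.ofPure, Sat, mem_ro_singleton, realize_allBelow,
      realize_exBelow, realize_exAbove, realize_fEq, relMap_refSymb, Fin.snoc_last]
  | top => simp only [ST, MForm.ofPure, Sat, BoundedFormula.realize_top]
  | bot => simp only [ST, MForm.ofPure, Sat, BoundedFormula.realize_bot]
  | neg a iha =>
    simp only [ST, MForm.ofPure, Sat, realize_allBelow, BoundedFormula.realize_not, iha,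
      relMap_refSymb, Fin.snoc_last]
  | and a b iha ihb => exact BoundedFormula.realize_inf.trans (and_congr iha ihb)
  | or a b iha ihb =>
    simp only [ST, MForm.ofPure, Sat, realize_allBelow, realize_exBelow,
      BoundedFormula.realize_sup, iha, ihb, relMap_refSymb, Fin.snoc_last]
  | imp a b iha ihb =>
    simp only [ST, MForm.ofPure, Sat, realize_allBelow, BoundedFormula.realize_imp, iha, ihb,
      relMap_refSymb, Fin.snoc_last]
  | box a iha =>
    simp only [ST, MForm.ofPure, Sat, realize_allSucc, iha, relMap_accSymb, Fin.snoc_last]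
  | dia a iha =>
    simp only [ST, MForm.ofPure, Sat, realize_allBelow, realize_exSucc, realize_exBelow, iha,
      relMap_refSymb, relMap_accSymb, Fin.snoc_last]
  | bdia a iha =>
    simp only [ST, roClosure, MForm.ofPure, Sat, realize_allBelow, realize_exBelow,
      realize_exAbove, realize_exPred, iha, relMap_refSymb, relMap_accSymb, Fin.snoc_last]
  | bbox a iha =>
    simp only [ST, MForm.ofPure, Sat, realize_allBelow, realize_allAbove, realize_allPred,
      realize_exBelow, iha, relMap_refSymb, relMap_accSymb, Fin.snoc_last]

lemma models_FO [DecidableEq N] {l : List (System Empty N)} :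
    F.Models (FO l) ↔ ∀ s ∈ l, F.Models (univClosure s.toFO) := by
  simp only [Models, Sentence.Realize, Formula.Realize, FO, BoundedFormula.realize_foldr_inf,
    List.forall_mem_map]

lemma IsFull.realize_ineq_toFO (hF : F.IsFull) {e : Ineq Empty N} {v : P → RegularOpen W}
    {u : N → W} :
    letI := F.toStructure
    e.toFO.Realize u ↔ hF.hybridAlgebra.Holds v u ⟨e.lhs.ofPure, e.rhs.ofPure⟩ := by
  let := F.toStructure
  rw [hF.holds_iff]
  simp only [Formula.Realize, Ineq.toFO, BoundedFormula.realize_all, BoundedFormula.realize_imp,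
    realize_ST (V := fun p => ((v p).val : Set W)), Fin.snoc_last]

variable [DecidableEq P] [DecidableEq N]

lemma IsFull.realize_system_toFO (hF : F.IsFull) {s : System Empty N} {v : P → RegularOpen W}
    {u : N → W} :
    letI := F.toStructure
    s.toFO.Realize u ↔ ((∀ e ∈ (System.ofPure s : System P N).prem, hF.hybridAlgebra.Holds v u e) →
      hF.hybridAlgebra.Holds v u (System.ofPure s : System P N).concl) := by
  let := F.toStructure
  simp only [System.toFO, System.ofPure, Formula.realize_imp, Formula.realize_iInf,
    Subtype.forall, Finset.forall_mem_image, hF.realize_ineq_toFO (v := v)]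

theorem IsFull.validSystem_ofPure_iff (hF : F.IsFull) {s : System Empty N} :
    hF.hybridAlgebra.ValidSystem (System.ofPure s : System P N) ↔
      F.Models (univClosure s.toFO) := by
  let := F.toStructure
  have := F.nonempty
  refine Iff.trans ?_ realize_univClosure.symm
  exact ⟨fun h u => hF.realize_system_toFO.mpr (h (fun _ => ⊤) u),
    fun h v u => hF.realize_system_toFO.mp (h u)⟩

end PossibilityFrame

end PossALBA

theorem mainTheorem1_general {P N W : Type*} [DecidableEq P] [DecidableEq N] [PartialOrder W]
    {e : PossALBA.Ineq P N} {A : (PossALBA.corrLang Empty).Sentence} (hA : PossALBA.Outputs e A)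
    {F : PossALBA.PossibilityFrame W} (hF : F.IsFull) : F.Valid e ↔ F.Models A := by
  obtain ⟨l, sys, hl, hsys, rfl⟩ := hA
  rw [hF.valid_iff, hF.hybridAlgebra.valid_iff_of_run hl hsys,
    PossALBA.PossibilityFrame.models_FO]
  simp only [hF.validSystem_ofPure_iff]


theorem mainTheorem1 {P : Type*} {N : Type*} [DecidableEq P] [DecidableEq N]
    (φ ψ : PossALBA.MForm P N) (hφ : φ.IsBasic) (hψ : ψ.IsBasic)
    (A : (PossALBA.corrLang Empty).Sentence) (hA : PossALBA.Outputs ⟨φ, ψ⟩ A)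
    {W : Type*} [PartialOrder W] (F : PossALBA.PossibilityFrame W) (hF : F.IsFull) :
    F.Valid (⟨φ, ψ⟩ : PossALBA.Ineq P N) ↔ F.Models A :=
  mainTheorem1_general hA hF
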